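/- Let $n$ be a natural number and $0<p<\infty$. For $j=1,\dots,n$ let $\mathcal H_j$ be a complex separable Hilbert space with a fixed orthogonal decomposition $\mathcal H_j=\bigoplus_{\ell=1}^{\infty} \mathcal H_{j,\ell}$ into finite-dimensional subspaces, and let $\{e_{j,\ell}^k\}_{1\le k\le d_{j,\ell}}$ be an orthonormal basis of $\mathcal H_{j,\ell}$, where $d_{j,\ell}=\dim \mathcal H_{j,\ell}$. The inner product $\langle\cdot,\cdot\rangle$ is linear in the second variable. A bounded operator $A_j$ on $\mathcal H_j$ is called invariant (a Fourier multiplier) relative to this decomposition if $A_j\mathcal H_{j,\ell}\subseteq \mathcal H_{j,\ell}$ for all $\ell$; its symbol is the family of matrices $\sigma_j(\ell)\in\mathbb C^{d_{j,\ell}\times d_{j,\ell}}$ with entries $\sigma_j(\ell)_{mk}=\langle e_{j,\ell}^m, A_j e_{j,\ell}^k\rangle$. A compact operator $T$ on a Hilbert space $\mathcal H$ belongs to the Schatten–von Neumann class $S_p(\mathcal H)$ if $\sum_i s_i(T)^p<\infty$, where the $s_i(T)$ are the singular values of $T$, i.e. the eigenvalues of $|T|=\sqrt{T^*T}$ counted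 with multiplicity; then $\|T\|_{S_p}=\left(\sum_i s_i(T)^p\right)^{1/p}$. For a $d\times d$ matrix $M$, $\|M\|_{S_p}$ is this quantity for $M$ as an operator on Euclidean space $\mathbb C^d$. For $T\in S_1(\mathcal H)$, $\operatorname{Tr}(T)=\sum_k\langle \phi_k,T\phi_k\rangle$, the sum being absolutely convergent and independent of the orthonormal basis $(\phi_k)$ of $\mathcal H$. Let $\bigotimes_{j=1}^n\mathcal H_j$ be the Hilbert space tensor product, i.e. the completion of the algebraic tensor product for the inner product with $\langle\otimes_j x_j,\otimes_j y_j\rangle=\prod_j\langle x_j,y_j\rangle$, and let $\bigotimes_{j=1}^n A_j$ be the bounded operator on it with $\otimes_j x_j\mapsto\otimes_j A_jx_j$. Suppose that, for each $j=1,\dots,n$, $A_j\in S_p(\mathcal H_j)$ is invariant with symbol $\sigma_j$. Then $\bigotimes_{j=1}^n A_j\in S_p\left(\bigotimes_{j=1}^n\mathcal H_j\right)$, and $$\Big\|\bigotimes_{j=1}^n A_j\Big\|_{S_p}=\prod_{j=1}^n\|A_j\|_{S_p}=\prod_{j=1}^n\Big(\sum_{\ell=1}^\infty\|\sigma_j(\ell)\|_{S_p}^p\Big)^{1/p},$$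 where the series on the right converge. If $p=1$, then in addition $$\operatorname{Tr}\Big(\bigotimes_{j=1}^n A_j\Big)=\prod_{j=1}^n\operatorname{Tr}(A_j)=\prod_{j=1}^n\Big(\sum_{\ell=1}^\infty\operatorname{Tr}(\sigma_j(\ell))\Big),$$ where the traces on the left and in the middle are well defined (absolutely convergent in every orthonormal basis, with the same sum) and the series on the right converge absolutely. -/

import Mathlib

open scoped ComplexConjugate

universe u

/-! ## The Hilbert tensor product of finitely many Hilbert spaces -/

section TensorProduct

variable {n : ℕ}

/-- The algebraic tensor product `H 0 ⊗ ⋯ ⊗ H (n - 1)` over `ℂ`. It is a type synonym of Mathlib's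
`PiTensorProduct`, because the latter already carries another norm (the projective one). -/
def AlgTensor (H : Fin n → Type u) [∀ i, NormedAddCommGroup (H i)]
    [∀ i, InnerProductSpace ℂ (H i)] : Type u :=
  PiTensorProduct ℂ H

namespace AlgTensor

variable (H : Fin n → Type u) [∀ i, NormedAddCommGroup (H i)] [∀ i, InnerProductSpace ℂ (H i)]

noncomputable instance instAddCommGroup : AddCommGroup (AlgTensor H) :=
  inferInstanceAs (AddCommGroup (PiTensorProduct ℂ H))

noncomputable instance instModule : Module ℂ (AlgTensor H) :=
  inferInstanceAs (Module ℂ (PiTensorProduct ℂ H))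

variable {H}

/-- The elementary tensor `x 0 ⊗ ⋯ ⊗ x (n - 1)`. -/
noncomputable def tprod (x : ∀ i, H i) : AlgTensor H := PiTensorProduct.tprod ℂ x

/-- The universal property: a multilinear map induces a linear map on the tensor product. -/
noncomputable def lift {F : Type*} [AddCommGroup F] [Module ℂ F] (f : MultilinearMap ℂ H F) :
    AlgTensor H →ₗ[ℂ] F :=
  PiTensorProduct.lift f

theorem lift_tprod {F : Type*} [AddCommGroup F] [Module ℂ F] (f : MultilinearMap ℂ H F)
    (x : ∀ i, H i) : lift f (tprod x) = f x :=
  PiTensorProduct.lift.tprod x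

/-- The linear form `v ↦ ⟪x 0 ⊗ ⋯ ⊗ x (n - 1), v⟫` on the algebraic tensor product. -/
noncomputable def innerLeft (x : ∀ i, H i) : AlgTensor H →ₗ[ℂ] ℂ :=
  lift ((MultilinearMap.mkPiAlgebra ℂ (Fin n) ℂ).compLinearMap fun i => (innerₛₗ ℂ (x i)))

theorem innerLeft_tprod (x y : ∀ i, H i) :
    innerLeft x (tprod y) = ∏ i, inner ℂ (x i) (y i) := by
  simp [innerLeft, lift_tprod]

theorem exists_eq_sum (u : AlgTensor H) :
    ∃ (m : ℕ) (x : Fin m → ∀ i, H i) (c : Fin m → ℂ), u = ∑ k, c k • tprod (x k) := by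
  have hu : u ∈ Submodule.span ℂ (Set.range (tprod (H := H))) := by
    have h : Submodule.span ℂ (Set.range (PiTensorProduct.tprod ℂ (s := H))) = ⊤ :=
      PiTensorProduct.span_tprod_eq_top
    have h2 : (u : PiTensorProduct ℂ H) ∈ (⊤ : Submodule ℂ (PiTensorProduct ℂ H)) := trivial
    rw [← h] at h2
    exact h2
  obtain ⟨m, c, g, h⟩ := (Submodule.mem_span_set').1 hu
  choose x hx using fun k => (g k).2
  exact ⟨m, x, c, by rw [← h]; simp [hx]⟩

theorem linearMap_ext {F : Type*} [AddCommGroup F] [Module ℂ F] {f g : AlgTensor H →ₗ[ℂ] F}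
    (h : ∀ x, f (tprod x) = g (tprod x)) : f = g := by
  ext u
  obtain ⟨m, x, c, rfl⟩ := exists_eq_sum u
  simp [h]

theorem innerLeft_update_add (x : ∀ i, H i) (i : Fin n) (a b : H i) :
    innerLeft (Function.update x i (a + b)) =
      innerLeft (Function.update x i a) + innerLeft (Function.update x i b) := by
  refine linearMap_ext fun y => ?_
  have key : ∀ z : ∀ i, H i, innerLeft z (tprod y) = conj (innerLeft y (tprod z)) := by
    intro z; simp [innerLeft_tprod, map_prod]
  rw [LinearMap.add_apply, key, key, key, ← map_add]
  congr 1
  rw [← map_add]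
  exact congrArg _ ((PiTensorProduct.tprod ℂ).map_update_add x i a b)

theorem innerLeft_update_smul (x : ∀ i, H i) (i : Fin n) (c : ℂ) (a : H i) :
    innerLeft (Function.update x i (c • a)) = conj c • innerLeft (Function.update x i a) := by
  refine linearMap_ext fun y => ?_
  have key : ∀ z : ∀ i, H i, innerLeft z (tprod y) = conj (innerLeft y (tprod z)) := by
    intro z; simp [innerLeft_tprod, map_prod]
  rw [LinearMap.smul_apply, key, key, smul_eq_mul, ← map_mul, ← smul_eq_mul c]
  congr 1
  rw [← map_smul]
  exact congrArg _ ((PiTensorProduct.tprod ℂ).map_update_smul x i c a)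

/-- The conjugate of the inner product, `u ↦ (v ↦ conj ⟪u, v⟫)`, linear in `u` and
conjugate-linear in `v`. -/
noncomputable def conjInner : AlgTensor H →ₗ[ℂ] (AlgTensor H →ₛₗ[starRingEnd ℂ] ℂ) :=
  lift
    { toFun := fun x =>
        { toFun := fun v => conj (innerLeft x v)
          map_add' := fun v w => by simp
          map_smul' := fun c v => by simp }
      map_update_add' := fun {inst} x i a b => by
        cases Subsingleton.elim inst (instDecidableEqFin n)
        ext v
        simp [innerLeft_update_add]
      map_update_smul' := fun {inst} x i c a => by
        cases Subsingleton.elim inst (instDecidableEqFin n)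
        ext v
        simp [innerLeft_update_smul] }

noncomputable instance instInner : Inner ℂ (AlgTensor H) := ⟨fun u v => conj (conjInner u v)⟩

theorem inner_def (u v : AlgTensor H) : inner ℂ u v = conj (conjInner u v) := rfl

theorem inner_tprod (x y : ∀ i, H i) :
    inner ℂ (tprod x) (tprod y) = ∏ i, inner ℂ (x i) (y i) := by
  have h : conjInner (tprod x) (tprod y) = conj (innerLeft x (tprod y)) := by
    rw [conjInner, lift_tprod]; rfl
  rw [inner_def, h, innerLeft_tprod, Complex.conj_conj]

theorem inner_sum_sum {m : ℕ} (x y : Fin m → ∀ i, H i) (c d : Fin m → ℂ) :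
    inner ℂ (∑ k, c k • tprod (x k)) (∑ l, d l • tprod (y l)) =
      ∑ k, ∑ l, conj (c k) * (d l * ∏ i, inner ℂ (x k i) (y l i)) := by
  simp_rw [← inner_tprod, inner_def]
  simp only [map_sum, LinearMap.sum_apply, map_smul, LinearMap.smul_apply, LinearMap.map_smulₛₗ,
    smul_eq_mul, map_mul, Complex.conj_conj, Finset.mul_sum]
  rw [Finset.sum_comm]
  exact Finset.sum_congr rfl fun _ _ => Finset.sum_congr rfl fun _ _ => by ring

open scoped ComplexOrder in
/-- Entrywise products of Gram matrices respect operator norm bounds. -/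
theorem posSemidef_prod {m : ℕ} (A : ∀ i, H i →L[ℂ] H i) (x : Fin m → ∀ i, H i)
    (s : Finset (Fin n)) :
    (Matrix.of fun k l => ∏ i ∈ s, inner ℂ (x k i) (x l i) : Matrix (Fin m) (Fin m) ℂ).PosSemidef ∧
    (Matrix.of fun k l => ((∏ i ∈ s, ‖A i‖ ^ 2 : ℝ) : ℂ) * (∏ i ∈ s, inner ℂ (x k i) (x l i)) -
      ∏ i ∈ s, inner ℂ (A i (x k i)) (A i (x l i)) : Matrix (Fin m) (Fin m) ℂ).PosSemidef := by
  induction s using Finset.induction_on with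
  | empty =>
    refine ⟨?_, ?_⟩
    · have h := Matrix.posSemidef_vecMulVec_self_star (fun _ : Fin m => (1 : ℂ))
      convert h using 1
      ext k l
      simp [Matrix.vecMulVec_apply]
    · convert Matrix.PosSemidef.zero (n := Fin m) (R := ℂ) using 1
      ext k l
      simp
  | insert a s ha ih =>
    obtain ⟨h1, h2⟩ := ih
    have g := Matrix.posSemidef_gram ℂ (fun k => x k a)
    have g' := Matrix.posSemidef_gram ℂ (fun k => A a (x k a))
    have d : (((‖A a‖ ^ 2 : ℝ) : ℂ) • Matrix.gram ℂ (fun k => x k a) -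
        Matrix.gram ℂ (fun k => A a (x k a))).PosSemidef := by
      refine .of_dotProduct_mulVec_nonneg ?_ fun z => ?_
      · refine Matrix.IsHermitian.sub ?_ g'.1
        ext k l
        simp
      · rw [Matrix.sub_mulVec, Matrix.smul_mulVec, dotProduct_sub, dotProduct_smul,
          Matrix.star_dotProduct_gram_mulVec, Matrix.star_dotProduct_gram_mulVec]
        have e : ∑ i, z i • A a (x i a) = A a (∑ i, z i • x i a) := by simp
        rw [e, inner_self_eq_norm_sq_to_K, inner_self_eq_norm_sq_to_K, smul_eq_mul]
        have := (A a).le_opNorm (∑ i, z i • x i a)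
        have h3 := pow_le_pow_left₀ (norm_nonneg _) this 2
        rw [mul_pow] at h3
        have h4 := sub_nonneg.2 h3
        have h5 := Complex.zero_le_real.2 h4
        push_cast at h5
        simpa using h5
    refine ⟨?_, ?_⟩
    · have e : (Matrix.of fun k l => ∏ i ∈ insert a s, inner ℂ (x k i) (x l i)) =
          (Matrix.gram ℂ fun k => x k a).hadamard
            (Matrix.of fun k l => ∏ i ∈ s, inner ℂ (x k i) (x l i)) := by
        ext k l
        simp [Finset.prod_insert ha]
      rw [e]
      exact g.hadamard h1
    · have e : (Matrix.of fun k l =>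
          ((∏ i ∈ insert a s, ‖A i‖ ^ 2 : ℝ) : ℂ) * (∏ i ∈ insert a s, inner ℂ (x k i) (x l i)) -
            ∏ i ∈ insert a s, inner ℂ (A i (x k i)) (A i (x l i))) =
          ((((∏ i ∈ s, ‖A i‖ ^ 2 : ℝ) : ℂ) • ((((‖A a‖ ^ 2 : ℝ) : ℂ) •
            Matrix.gram ℂ (fun k => x k a) - Matrix.gram ℂ (fun k => A a (x k a))).hadamard
            (Matrix.of fun k l => ∏ i ∈ s, inner ℂ (x k i) (x l i)))) +
          (Matrix.gram ℂ (fun k => A a (x k a))).hadamard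
            (Matrix.of fun k l => ((∏ i ∈ s, ‖A i‖ ^ 2 : ℝ) : ℂ) *
              (∏ i ∈ s, inner ℂ (x k i) (x l i)) -
              ∏ i ∈ s, inner ℂ (A i (x k i)) (A i (x l i))) : Matrix (Fin m) (Fin m) ℂ) := by
        ext k l
        simp [Finset.prod_insert ha]
        ring
      rw [e]
      exact ((d.hadamard h1).smul (Complex.zero_le_real.2
        (Finset.prod_nonneg fun i _ => sq_nonneg ‖A i‖))).add (g'.hadamard h2)

theorem re_inner_self_map_le (A : ∀ i, H i →L[ℂ] H i) {m : ℕ} (x : Fin m → ∀ i, H i)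
    (c : Fin m → ℂ) :
    0 ≤ (inner ℂ (∑ k, c k • tprod (x k)) (∑ k, c k • tprod (x k))).re ∧
    (inner ℂ (∑ k, c k • tprod fun i => A i (x k i)) (∑ k, c k • tprod fun i => A i (x k i))).re ≤
      (∏ i, ‖A i‖ ^ 2) * (inner ℂ (∑ k, c k • tprod (x k)) (∑ k, c k • tprod (x k))).re := by
  obtain ⟨h1, h2⟩ := posSemidef_prod A x Finset.univ
  have h1' := h1.re_dotProduct_nonneg c
  have h2' := h2.re_dotProduct_nonneg c
  have e : ∀ y : Fin m → ∀ i, H i, inner ℂ (∑ k, c k • tprod (y k)) (∑ k, c k • tprod (y k)) =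
      star c ⬝ᵥ (Matrix.of fun k l => ∏ i, inner ℂ (y k i) (y l i)).mulVec c := by
    intro y
    simp only [inner_sum_sum, dotProduct, Matrix.mulVec, Finset.mul_sum, Matrix.of_apply]
    exact Finset.sum_congr rfl fun _ _ => Finset.sum_congr rfl fun _ _ => by
      simp only [Pi.star_apply, RCLike.star_def]; ring
  rw [e, e]
  refine ⟨h1', ?_⟩
  have e2 : (Matrix.of fun k l => ((∏ i, ‖A i‖ ^ 2 : ℝ) : ℂ) * (∏ i, inner ℂ (x k i) (x l i)) -
      ∏ i, inner ℂ (A i (x k i)) (A i (x l i)) : Matrix (Fin m) (Fin m) ℂ) =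
      ((∏ i, ‖A i‖ ^ 2 : ℝ) : ℂ) • (Matrix.of fun k l => ∏ i, inner ℂ (x k i) (x l i)) -
      (Matrix.of fun k l => ∏ i, inner ℂ (A i (x k i)) (A i (x l i))) := by
    ext k l; simp
  rw [e2, Matrix.sub_mulVec, Matrix.smul_mulVec, dotProduct_sub, dotProduct_smul, smul_eq_mul,
    map_sub] at h2'
  change 0 ≤ (_ * _ : ℂ).re - Complex.re _ at h2'
  rw [Complex.re_ofReal_mul] at h2'
  exact sub_nonneg.1 h2'

/-- The pre-inner product with `⟪⊗ x i, ⊗ y i⟫ = ∏ ⟪x i, y i⟫`. -/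
@[reducible]
noncomputable def core (H : Fin n → Type u) [∀ i, NormedAddCommGroup (H i)]
    [∀ i, InnerProductSpace ℂ (H i)] : PreInnerProductSpace.Core ℂ (AlgTensor H) where
  toInner := instInner
  conj_inner_symm u v := by
    obtain ⟨m, x, c, rfl⟩ := exists_eq_sum u
    obtain ⟨m', y, d, rfl⟩ := exists_eq_sum v
    have h : ∀ x y : ∀ i, H i, conj (inner ℂ (tprod y) (tprod x)) = inner ℂ (tprod x) (tprod y) := by
      intro x y
      simp [inner_tprod, map_prod]
    simp only [inner_def, Complex.conj_conj] at h
    simp only [inner_def, map_sum, LinearMap.sum_apply, map_smul, LinearMap.smul_apply,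
      LinearMap.map_smulₛₗ, smul_eq_mul, map_mul, Complex.conj_conj, Finset.mul_sum]
    rw [Finset.sum_comm]
    refine Finset.sum_congr rfl fun _ _ => Finset.sum_congr rfl fun _ _ => ?_
    rw [h]; ring
  re_inner_nonneg u := by
    obtain ⟨m, x, c, rfl⟩ := exists_eq_sum u
    exact (re_inner_self_map_le (fun _ => 0) x c).1
  add_left u v w := by simp [inner_def]
  smul_left u v c := by simp [inner_def]

noncomputable instance instSeminormedAddCommGroup : SeminormedAddCommGroup (AlgTensor H) :=
  letI := core H
  InnerProductSpace.Core.toSeminormedAddCommGroup (𝕜 := ℂ)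

noncomputable instance instInnerProductSpace : InnerProductSpace ℂ (AlgTensor H) :=
  InnerProductSpace.ofCore (core H)

/-- The algebraic tensor product of bounded operators:
`⊗ x i ↦ ⊗ A i (x i)`, which is bounded with norm at most `∏ ‖A i‖`. -/
noncomputable def mapₗ (A : ∀ i, H i →L[ℂ] H i) : AlgTensor H →ₗ[ℂ] AlgTensor H :=
  PiTensorProduct.map fun i => (A i : H i →ₗ[ℂ] H i)

theorem mapₗ_tprod (A : ∀ i, H i →L[ℂ] H i) (x : ∀ i, H i) :
    mapₗ A (tprod x) = tprod fun i => A i (x i) :=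
  PiTensorProduct.map_tprod _ _

theorem norm_mapₗ_le (A : ∀ i, H i →L[ℂ] H i) (u : AlgTensor H) :
    ‖mapₗ A u‖ ≤ (∏ i, ‖A i‖) * ‖u‖ := by
  obtain ⟨m, x, c, rfl⟩ := exists_eq_sum u
  have h := (re_inner_self_map_le A x c).2
  refine le_of_sq_le_sq ?_ (by positivity)
  rw [mul_pow, ← Finset.prod_pow, InnerProductSpace.norm_sq_eq_re_inner (𝕜 := ℂ),
    InnerProductSpace.norm_sq_eq_re_inner (𝕜 := ℂ)]
  simp only [map_sum, map_smul, mapₗ_tprod]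
  exact h

/-- The tensor product of bounded operators on the algebraic tensor product. -/
noncomputable def map (A : ∀ i, H i →L[ℂ] H i) : AlgTensor H →L[ℂ] AlgTensor H :=
  (mapₗ A).mkContinuous (∏ i, ‖A i‖) (norm_mapₗ_le A)

end AlgTensor

/-- The Hilbert tensor product `H 0 ⊗ ⋯ ⊗ H (n - 1)`: the completion of the algebraic tensor
product with respect to the inner product `⟪⊗ x i, ⊗ y i⟫ = ∏ ⟪x i, y i⟫`. -/
abbrev HilbertTensor (H : Fin n → Type u) [∀ i, NormedAddCommGroup (H i)]
    [∀ i, InnerProductSpace ℂ (H i)] : Type u :=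
  UniformSpace.Completion (AlgTensor H)

namespace HilbertTensor

variable {H : Fin n → Type u} [∀ i, NormedAddCommGroup (H i)] [∀ i, InnerProductSpace ℂ (H i)]

/-- The elementary tensor `x 0 ⊗ ⋯ ⊗ x (n - 1)` in the Hilbert tensor product. -/
noncomputable def tprod (x : ∀ i, H i) : HilbertTensor H := (AlgTensor.tprod x : AlgTensor H)

/-- The tensor product `A 0 ⊗ ⋯ ⊗ A (n - 1)` of bounded operators: the extension by continuity of
`⊗ x i ↦ ⊗ A i (x i)`. -/
noncomputable def map (A : ∀ i, H i →L[ℂ] H i) : HilbertTensor H →L[ℂ] HilbertTensor H :=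
  (AlgTensor.map A).completion

theorem inner_tprod (x y : ∀ i, H i) :
    inner ℂ (tprod x) (tprod y) = ∏ i, inner ℂ (x i) (y i) := by
  rw [tprod, tprod, UniformSpace.Completion.inner_coe]
  exact AlgTensor.inner_tprod x y

theorem map_tprod (A : ∀ i, H i →L[ℂ] H i) (x : ∀ i, H i) :
    map A (tprod x) = tprod fun i => A i (x i) := by
  rw [tprod, map, ContinuousLinearMap.completion_apply_coe]
  exact congrArg _ (AlgTensor.mapₗ_tprod A x)

theorem dense_span_tprod :
    Dense (Submodule.span ℂ (Set.range (tprod (H := H))) : Set (HilbertTensor H)) := by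
  refine UniformSpace.Completion.denseRange_coe.mono ?_
  rintro _ ⟨u, rfl⟩
  obtain ⟨m, x, c, rfl⟩ := AlgTensor.exists_eq_sum u
  have h : ((∑ k, c k • AlgTensor.tprod (x k) : AlgTensor H) : HilbertTensor H) =
      ∑ k, c k • tprod (x k) := by
    change UniformSpace.Completion.toComplₗᵢ (𝕜 := ℂ) _ = _
    simp [tprod]
  rw [h]
  exact Submodule.sum_mem _ fun k _ =>
    Submodule.smul_mem _ _ (Submodule.subset_span (Set.mem_range_self _))

end HilbertTensor
end TensorProduct

/-! ## Schatten-von Neumann classes and the trace -/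

section Schatten

variable {E : Type u} [NormedAddCommGroup E] [InnerProductSpace ℂ E] [CompleteSpace E]

/-- The index set that lists the positive eigenvalues `μ` of `|T| = √(T* T)`, each repeated as
often as its multiplicity. (For compact `T` these multiplicities are finite. The eigenvalue `0`
contributes nothing to the sums below and is left out.) -/
abbrev SingularIndex (T : E →L[ℂ] E) : Type :=
  Σ μ : {μ : ℝ // 0 < μ},
    Fin (Module.finrank ℂ (Module.End.eigenspace ((CFC.abs T : E →L[ℂ] E) : E →ₗ[ℂ] E) ((μ : ℝ) : ℂ)))

/-- The nonzero singular values of `T`: the positive eigenvalues of `|T|`, counted with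
multiplicity. -/
def singularValue (T : E →L[ℂ] E) (i : SingularIndex T) : ℝ := i.1

/-- `T ∈ S_p(E)`: the operator `T` is compact and `∑ s_i(T)^p < ∞`. -/
def MemSchatten (p : ℝ) (T : E →L[ℂ] E) : Prop :=
  IsCompactOperator T ∧ Summable fun i : SingularIndex T => singularValue T i ^ p

/-- The Schatten (quasi-)norm `‖T‖_{S_p} = (∑ s_i(T)^p)^(1/p)`. -/
noncomputable def schattenNorm (p : ℝ) (T : E →L[ℂ] E) : ℝ :=
  (∑' i : SingularIndex T, singularValue T i ^ p) ^ (1 / p)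

/-- The trace `∑ ⟪b k, T (b k)⟫`, computed in some orthonormal basis `b` of `E`. -/
noncomputable def opTrace (T : E →L[ℂ] E) : ℂ :=
  ∑' k, inner ℂ ((exists_hilbertBasis ℂ E).choose_spec.choose k)
    (T ((exists_hilbertBasis ℂ E).choose_spec.choose k))

/-- In every orthonormal basis `b` of `E` the series `∑ ⟪b k, T (b k)⟫` converges absolutely,
with sum `t`. -/
def HasTrace (T : E →L[ℂ] E) (t : ℂ) : Prop :=
  ∀ (ι : Type u) (b : HilbertBasis ι ℂ E), HasSum (fun k => inner ℂ (b k) (T (b k))) t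

end Schatten

/-! ## Invariant operators relative to a partition, and their symbols -/

/-- A decomposition of a Hilbert space `E` as the orthogonal direct sum of finite dimensional
subspaces `E_ℓ`, `ℓ ∈ ℕ`, with `dim E_ℓ = dim ℓ`, and with an orthonormal basis
`e_ℓ^k = basis ⟨ℓ, k⟩`, `k < dim ℓ`, of each `E_ℓ`. -/
structure HilbertPartition (E : Type u) [NormedAddCommGroup E] [InnerProductSpace ℂ E] where
  dim : ℕ → ℕ
  basis : HilbertBasis (Σ ℓ : ℕ, Fin (dim ℓ)) ℂ E

namespace HilbertPartition

variable {E : Type u} [NormedAddCommGroup E] [InnerProductSpace ℂ E] (P : HilbertPartition E)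

/-- The finite dimensional subspace `E_ℓ` of the partition. -/
def component (ℓ : ℕ) : Submodule ℂ E :=
  Submodule.span ℂ (Set.range fun k : Fin (P.dim ℓ) => P.basis ⟨ℓ, k⟩)

/-- `T` is invariant (a Fourier multiplier) relative to the partition: `T E_ℓ ⊆ E_ℓ` for all `ℓ`. -/
def IsInvariant (T : E →L[ℂ] E) : Prop :=
  ∀ ℓ, ∀ x ∈ P.component ℓ, T x ∈ P.component ℓ

/-- The matrix symbol `σ(ℓ)` of `T`, with entries `σ(ℓ)_{mk} = ⟪e_ℓ^m, T e_ℓ^k⟫` (the inner product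
being linear in the second variable). -/
noncomputable def symbol (T : E →L[ℂ] E) (ℓ : ℕ) : Matrix (Fin (P.dim ℓ)) (Fin (P.dim ℓ)) ℂ :=
  Matrix.of fun m k => inner ℂ (P.basis ⟨ℓ, m⟩) (T (P.basis ⟨ℓ, k⟩))

end HilbertPartition

/-- The Schatten (quasi-)norm of a square matrix, as an operator on Euclidean space `ℂ^d`. -/
noncomputable def matrixSchattenNorm (p : ℝ) {d : ℕ} (M : Matrix (Fin d) (Fin d) ℂ) : ℝ :=
  schattenNorm p (Matrix.toEuclideanCLM (𝕜 := ℂ) M)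

/-! ## Products of absolutely convergent series -/

/-! Everything reduces to orthonormal bases `b` for which the vectors `T (b i)` are pairwise
orthogonal. For such `b` the operator `T* T` is diagonal, so `|T|` has eigenvalues `‖T (b i)‖`, and
for compact `T` the Schatten sum is `∑ ‖T (b i)‖ ^ p` (`hasSum_singularValue_rpow_iff`).

An invariant operator has such a basis: on each block it acts as its symbol, so eigenvectors of
`σ(ℓ)* σ(ℓ)` can be glued over all blocks (`IsInvariant.exists_hilbertBasis`). Grouping the Schatten
sum by blocks gives the formula in terms of the symbols.

The property passes to tensor products: elementary tensors of these bases form an orthonormal basis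
whose image is again orthogonal, with norms `∏ ‖A j (b j (i j))‖`. The Schatten sum then factors as
a product of absolutely convergent series, and its convergence also yields compactness.

For `p = 1`, summability of `‖T (b i)‖` in a single basis forces the trace series to converge to the
same value in every basis (`hasSum_inner_apply_of_summable_norm`), so each trace may be computed in
whichever basis is convenient. -/

theorem summable_norm_prod_and_tsum_prod_eq {R : Type*} [NormedField R] [CompleteSpace R] {n : ℕ}
    {ι : Fin n → Type*} {f : ∀ j, ι j → R} (hf : ∀ j, Summable fun k => ‖f j k‖) :
    (Summable fun i : ∀ j, ι j => ‖∏ j, f j (i j)‖) ∧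
      ∑' i : ∀ j, ι j, ∏ j, f j (i j) = ∏ j, ∑' k, f j k := by
  induction n with
  | zero => exact ⟨(hasSum_fintype _).summable, by simp⟩
  | succ n ih =>
    obtain ⟨h1, h2⟩ := ih fun j => hf j.succ
    have e (x : ι 0 × ∀ j : Fin n, ι j.succ) :
        ∏ j, f j (Fin.consEquiv ι x j) = f 0 x.1 * ∏ j : Fin n, f j.succ (x.2 j) := by
      simp [Fin.prod_univ_succ, Fin.consEquiv]
    refine ⟨?_, ?_⟩
    · rw [← (Fin.consEquiv ι).summable_iff]
      refine ((hf 0).mul_norm h1).congr fun x => ?_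
      simp only [Function.comp_apply, e]
    · rw [← (Fin.consEquiv ι).tsum_eq, Fin.prod_univ_succ, ← h2,
        tsum_mul_tsum_of_summable_norm (hf 0) h1]
      exact tsum_congr e

/-! ## Operators that map an orthonormal basis to an orthogonal family -/

section OrthogonalImage

theorem HilbertBasis.ext_inner_left {E : Type*} [NormedAddCommGroup E]
    [InnerProductSpace ℂ E] {ι : Type*} (b : HilbertBasis ι ℂ E)
    {x y : E}     (h : ∀ i, inner ℂ (b i) x = inner ℂ (b i) y) : x = y := by
  apply b.repr.injective
  ext i
  simpa [b.repr_apply_apply] using h i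

variable {E : Type u} [NormedAddCommGroup E] [InnerProductSpace ℂ E] [CompleteSpace E]
  {ι : Type*} {T : E →L[ℂ] E}

/-- The matrix entries of `T* T` in `b` are `⟪T (b j), T (b i)⟫`, so orthogonality of the images
makes this matrix diagonal. -/
theorem adjoint_apply_apply_of_pairwise_inner_eq_zero (b : HilbertBasis ι ℂ E)
    (hb : Pairwise fun i j => inner ℂ (T (b i)) (T (b j)) = 0) (i : ι) :
    (ContinuousLinearMap.adjoint T) (T (b i)) = ((‖T (b i)‖ : ℂ) ^ 2) • b i := by
  refine b.ext_inner_left fun j => ?_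
  rw [ContinuousLinearMap.adjoint_inner_right, inner_smul_right]
  rcases eq_or_ne j i with rfl | h
  · rw [inner_self_eq_norm_sq_to_K, inner_self_eq_norm_sq_to_K, b.orthonormal.1]
    simp
  · rw [hb h, b.orthonormal.2 h, mul_zero]

/-- Put `S = |T|`, `r = ‖T (b i)‖` and `y = (S - r) (b i)`. Since `S² (b i) = r² b i`, one has `S y
= -r y`. If `r > 0`, positivity of `S` forces `y = 0`; if `r = 0`, then `‖S (b i)‖² = ⟪b i, S² (b
i)⟫ = 0`. -/
theorem abs_apply_of_pairwise_inner_eq_zero (b : HilbertBasis ι ℂ E)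
    (hb : Pairwise fun i j => inner ℂ (T (b i)) (T (b j)) = 0) (i : ι) :
    (CFC.abs T) (b i) = (‖T (b i)‖ : ℂ) • b i := by
  set S : E →L[ℂ] E := CFC.abs T with hS
  set r : ℝ := ‖T (b i)‖ with hr
  have hpos : S.IsPositive := by
    rw [← ContinuousLinearMap.nonneg_iff_isPositive]
    exact CFC.abs_nonneg T
  have hsq : S (S (b i)) = ((r : ℂ) ^ 2) • b i := by
    rw [← adjoint_apply_apply_of_pairwise_inner_eq_zero b hb i]
    exact congrArg (fun A : E →L[ℂ] E => A (b i)) (CFC.abs_mul_abs T)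
  have hsymm := hpos.isSymmetric
  set y : E := S (b i) - (r : ℂ) • b i with hy
  have hSy : S y = -((r : ℂ) • y) := by
    rw [hy, map_sub, hsq, map_smul, smul_sub, smul_smul, pow_two]
    abel
  rw [← sub_eq_zero, ← hy]
  rcases (norm_nonneg (T (b i))).eq_or_lt with h0 | h0
  · have hr0 : r = 0 := h0.symm
    have h1 : S (b i) = y := by simp [hy, hr0]
    have h2 : inner ℂ (S (b i)) (S (b i)) = 0 := by
      have := hsymm (b i) (S (b i))
      simp only [ContinuousLinearMap.coe_coe] at this
      rw [this, hsq, hr0]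
      simp
    rw [← h1]
    exact inner_self_eq_zero.1 h2
  · have h1 := hpos.re_inner_nonneg_left y
    rw [hSy, inner_neg_left, inner_smul_left, inner_self_eq_norm_sq_to_K] at h1
    have h2 : 0 ≤ -(r * ‖y‖ ^ 2) := by
      have e : -((conj (r : ℂ)) * ((‖y‖ : ℂ)) ^ 2) = ((-(r * ‖y‖ ^ 2) : ℝ) : ℂ) := by
        push_cast; simp
      have h3 : 0 ≤ (-((conj (r : ℂ)) * ((‖y‖ : ℂ)) ^ 2)).re := h1
      rw [e] at h3
      exact h3
    have h3 : ‖y‖ ^ 2 ≤ 0 := by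
      have : 0 < r := h0
      by_contra! h
      have := mul_pos this h
      linarith
    have h4 : ‖y‖ = 0 := by
      have := sq_nonneg ‖y‖
      exact pow_eq_zero_iff (two_ne_zero) |>.1 (le_antisymm h3 this)
    exact norm_eq_zero.1 h4

/-- These `b i` are independent vectors in the eigenspace of the compact operator `T* T` at `μ² ≠
0`, which is finite dimensional. -/
theorem finite_setOf_norm_apply_eq (hT : IsCompactOperator T) (b : HilbertBasis ι ℂ E)
    (hb : Pairwise fun i j => inner ℂ (T (b i)) (T (b j)) = 0) {μ : ℝ} (hμ : 0 < μ) :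
    Finite {i // ‖T (b i)‖ = μ} := by
  have hc : IsCompactOperator (ContinuousLinearMap.adjoint T ∘L T) :=
    hT.clm_comp (ContinuousLinearMap.adjoint T)
  have hfin := ContinuousLinearMap.finite_dimensional_eigenspace hc ((μ : ℂ) ^ 2)
    (by simpa using hμ.ne')
  have hmem (i : {i // ‖T (b i)‖ = μ}) :
      b i ∈ Module.End.eigenspace (ContinuousLinearMap.adjoint T ∘L T).toLinearMap
        ((μ : ℂ) ^ 2) := by
    rw [Module.End.mem_eigenspace_iff]
    have := adjoint_apply_apply_of_pairwise_inner_eq_zero b hb i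
    rw [i.2] at this
    exact this
  have hli : LinearIndependent ℂ fun i : {i // ‖T (b i)‖ = μ} =>
      (⟨b i, hmem i⟩ : Module.End.eigenspace (ContinuousLinearMap.adjoint T ∘L T).toLinearMap
        ((μ : ℂ) ^ 2)) := by
    refine LinearIndependent.of_comp (Submodule.subtype _) ?_
    exact b.orthonormal.linearIndependent.comp _ Subtype.val_injective
  exact hli.finite

/-- The eigenspace is spanned by the `b i` with `‖T (b i)‖ = μ`: symmetry of `|T|` gives `(‖T (b i)‖
- μ) ⟪b i, x⟫ = 0` for an eigenvector `x`, so all its other coordinates vanish. -/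
theorem finrank_eigenspace_abs (hT : IsCompactOperator T) (b : HilbertBasis ι ℂ E)
    (hb : Pairwise fun i j => inner ℂ (T (b i)) (T (b j)) = 0) {μ : ℝ} (hμ : 0 < μ) :
    Module.finrank ℂ (Module.End.eigenspace ((CFC.abs T : E →L[ℂ] E) : E →ₗ[ℂ] E) (μ : ℂ)) =
      Nat.card {i // ‖T (b i)‖ = μ} := by
  have := finite_setOf_norm_apply_eq hT b hb hμ
  have := Fintype.ofFinite {i // ‖T (b i)‖ = μ}
  have hli : LinearIndependent ℂ fun i : {i // ‖T (b i)‖ = μ} => b i :=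
    b.orthonormal.linearIndependent.comp _ Subtype.val_injective
  rw [Nat.card_eq_fintype_card, ← finrank_span_eq_card hli]
  have habs := abs_apply_of_pairwise_inner_eq_zero b hb
  have hsymm : ((CFC.abs T : E →L[ℂ] E) : E →ₗ[ℂ] E).IsSymmetric :=
    ((ContinuousLinearMap.nonneg_iff_isPositive _).1 (CFC.abs_nonneg T)).isSymmetric
  suffices h : Module.End.eigenspace ((CFC.abs T : E →L[ℂ] E) : E →ₗ[ℂ] E) (μ : ℂ) =
      Submodule.span ℂ (Set.range fun i : {i // ‖T (b i)‖ = μ} => b i) by rw [h]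
  apply le_antisymm
  · intro x hx
    rw [Module.End.mem_eigenspace_iff] at hx
    have hz (i : ι) (hi : ‖T (b i)‖ ≠ μ) : inner ℂ (b i) x = 0 := by
      have h1 := hsymm (b i) x
      rw [hx, ContinuousLinearMap.coe_coe, habs, inner_smul_left, inner_smul_right,
        Complex.conj_ofReal, ← sub_eq_zero, ← sub_mul, mul_eq_zero] at h1
      refine h1.resolve_left fun h => hi ?_
      exact_mod_cast sub_eq_zero.1 h
    have hsum := b.hasSum_repr x
    have hx' : x = ∑ i : {i // ‖T (b i)‖ = μ}, b.repr x i • b i := by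
      refine hsum.unique ?_
      have h2 := hasSum_fintype fun i : {i // ‖T (b i)‖ = μ} => b.repr x i • b i
      refine (hasSum_subtype_iff_of_support_subset (s := {i | ‖T (b i)‖ = μ}) ?_).1 h2
      intro i hi
      by_contra hne
      refine hi ?_
      simp only [b.repr_apply_apply, hz i hne, zero_smul]
    rw [hx']
    exact Submodule.sum_mem _ fun i _ => Submodule.smul_mem _ _
      (Submodule.subset_span (Set.mem_range_self i))
  · rw [Submodule.span_le]
    rintro _ ⟨i, rfl⟩
    rw [SetLike.mem_coe, Module.End.mem_eigenspace_iff, ContinuousLinearMap.coe_coe, habs, i.2]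

/-- Multiplicities equal the sizes of the level sets of `i ↦ ‖T (b i)‖`, so the singular indices
biject with the `i` where `T (b i) ≠ 0`. The other `i` contribute `0 ^ p = 0`, as `p > 0`. -/
theorem hasSum_singularValue_rpow_iff (hT : IsCompactOperator T) (b : HilbertBasis ι ℂ E)
    (hb : Pairwise fun i j => inner ℂ (T (b i)) (T (b j)) = 0) {p : ℝ} (hp : 0 < p) {a : ℝ} :
    HasSum (fun i : SingularIndex T => singularValue T i ^ p) a ↔
      HasSum (fun i => ‖T (b i)‖ ^ p) a := by
  have hc (μ : {μ : ℝ // 0 < μ}) : Nonempty (Fin (Module.finrank ℂ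
      (Module.End.eigenspace ((CFC.abs T : E →L[ℂ] E) : E →ₗ[ℂ] E) ((μ : ℝ) : ℂ))) ≃
      {i // ‖T (b i)‖ = μ}) := by
    have := finite_setOf_norm_apply_eq hT b hb μ.2
    rw [finrank_eigenspace_abs hT b hb μ.2]
    exact ⟨(Finite.equivFin _).symm⟩
  let e : SingularIndex T ≃ Σ μ : {μ : ℝ // 0 < μ}, {i // ‖T (b i)‖ = μ} :=
    Equiv.sigmaCongrRight fun μ => (hc μ).some
  let g : (Σ μ : {μ : ℝ // 0 < μ}, {i // ‖T (b i)‖ = μ}) → ι := fun x => x.2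
  have hg : Function.Injective (g ∘ e) := by
    refine Function.Injective.comp ?_ e.injective
    rintro ⟨⟨μ, h⟩, ⟨i, hi⟩⟩ ⟨⟨ν, h'⟩, ⟨j, hj⟩⟩ (rfl : i = j)
    obtain rfl : μ = ν := hi.symm.trans hj
    rfl
  have hval (i : SingularIndex T) : ‖T (b (g (e i)))‖ = singularValue T i := (e i).2.2
  rw [← hg.hasSum_iff]
  · exact iff_of_eq (congrArg (fun f => HasSum f a) (funext fun i => by
      simp only [Function.comp_apply, hval]))
  · intro i hi
    rcases (norm_nonneg (T (b i))).eq_or_lt with h | h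
    · rw [← h, Real.zero_rpow hp.ne']
    · refine absurd ⟨e.symm ⟨⟨_, h⟩, ⟨i, rfl⟩⟩, ?_⟩ hi
      rw [Function.comp_apply, Equiv.apply_symm_apply]

theorem schattenNorm_eq_tsum (hT : IsCompactOperator T) (b : HilbertBasis ι ℂ E)
    (hb : Pairwise fun i j => inner ℂ (T (b i)) (T (b j)) = 0) {p : ℝ} (hp : 0 < p) :
    schattenNorm p T = (∑' i, ‖T (b i)‖ ^ p) ^ (1 / p) := by
  rw [schattenNorm]
  congr 1
  by_cases h : Summable fun i => ‖T (b i)‖ ^ p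
  · exact ((hasSum_singularValue_rpow_iff hT b hb hp).2 h.hasSum).tsum_eq
  -- The two series diverge together, and then both sums take the default value `0`.
  · rw [tsum_eq_zero_of_not_summable h, tsum_eq_zero_of_not_summable]
    rintro ⟨a, ha⟩
    exact h ⟨a, (hasSum_singularValue_rpow_iff hT b hb hp).1 ha⟩

theorem memSchatten_iff_summable (hT : IsCompactOperator T) (b : HilbertBasis ι ℂ E)
    (hb : Pairwise fun i j => inner ℂ (T (b i)) (T (b j)) = 0) {p : ℝ} (hp : 0 < p) :
    MemSchatten p T ↔ Summable fun i => ‖T (b i)‖ ^ p := by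
  refine ⟨fun ⟨_, a, ha⟩ => ⟨a, (hasSum_singularValue_rpow_iff hT b hb hp).1 ha⟩, fun ⟨a, ha⟩ =>
    ⟨hT, a, (hasSum_singularValue_rpow_iff hT b hb hp).2 ha⟩⟩

end OrthogonalImage

/-! ### Operator norm and compactness from the values on such a basis -/

section OrthogonalImage

variable {E : Type u} [NormedAddCommGroup E] [InnerProductSpace ℂ E] [CompleteSpace E]
  {ι : Type*} {T : E →L[ℂ] E}

/-- A weighted Parseval identity: expand the second `x` of `⟪T x, T x⟫` in `b` and use that `T* T`
is diagonal. -/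
theorem hasSum_norm_sq_apply (b : HilbertBasis ι ℂ E)
    (hb : Pairwise fun i j => inner ℂ (T (b i)) (T (b j)) = 0) (x : E) :
    HasSum (fun i => ‖T (b i)‖ ^ 2 * ‖inner ℂ (b i) x‖ ^ 2) (‖T x‖ ^ 2) := by
  have h1 := (b.hasSum_repr x).mapL (innerSL ℂ (T x) ∘L T)
  have h2 := Complex.reCLM.hasSum h1
  have e : Complex.reCLM ((innerSL ℂ (T x) ∘L T) x) = ‖T x‖ ^ 2 := by
    rw [InnerProductSpace.norm_sq_eq_re_inner (𝕜 := ℂ)]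
    rfl
  rw [e] at h2
  refine h2.congr_fun fun i => ?_
  have h3 : inner ℂ (T x) (T (b i)) = (‖T (b i)‖ : ℂ) ^ 2 * conj (inner ℂ (b i) x) := by
    rw [← ContinuousLinearMap.adjoint_inner_right,
      adjoint_apply_apply_of_pairwise_inner_eq_zero b hb, inner_smul_right, inner_conj_symm]
  have h4 : (innerSL ℂ (T x) ∘L T) (b.repr x i • b i) =
      ((‖T (b i)‖ ^ 2 * ‖inner ℂ (b i) x‖ ^ 2 : ℝ) : ℂ) := by
    rw [map_smul, b.repr_apply_apply, smul_eq_mul]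
    change _ * inner ℂ (T x) (T (b i)) = _
    rw [h3, mul_left_comm, Complex.mul_conj']
    push_cast
    ring
  rw [h4]
  rfl

theorem opNorm_le_of_pairwise_inner_eq_zero (b : HilbertBasis ι ℂ E)
    (hb : Pairwise fun i j => inner ℂ (T (b i)) (T (b j)) = 0) {C : ℝ} (hC : 0 ≤ C)
    (h : ∀ i, ‖T (b i)‖ ≤ C) : ‖T‖ ≤ C := by
  refine T.opNorm_le_bound hC fun x => ?_
  refine le_of_sq_le_sq ?_ (by positivity)
  have h1 : HasSum (fun i => C ^ 2 * ‖inner ℂ (b i) x‖ ^ 2) (C ^ 2 * ‖x‖ ^ 2) := by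
    refine HasSum.mul_left _ ?_
    -- Parseval's identity is the case of the identity operator.
    have := hasSum_norm_sq_apply (T := ContinuousLinearMap.id ℂ E) b
      (fun i j hij => b.orthonormal.2 hij) x
    simpa [b.orthonormal.1] using this
  rw [mul_pow]
  refine hasSum_le (fun i => ?_) (hasSum_norm_sq_apply b hb x) h1
  gcongr
  exact h i

/-- Keeping only the finitely many `b i` with `‖T (b i)‖ ≥ ε / 2` gives a finite-rank `S`. The
images of `b` under `T - S` are still orthogonal, with norm at most `ε / 2`, so `T` is a norm limit
of compact operators. -/
theorem isCompactOperator_of_pairwise_inner_eq_zero (b : HilbertBasis ι ℂ E)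
    (hb : Pairwise fun i j => inner ℂ (T (b i)) (T (b j)) = 0)
    (h : ∀ ε > 0, {i | ε ≤ ‖T (b i)‖}.Finite) : IsCompactOperator T := by
  classical
  suffices hcl : T ∈ closure {S : E →L[ℂ] E | IsCompactOperator S} by
    rwa [isClosed_setOfPred_isCompactOperator.closure_eq] at hcl
  rw [Metric.mem_closure_iff]
  intro ε hε
  set s := (h (ε / 2) (half_pos hε)).toFinset with hs
  set S : E →L[ℂ] E := ∑ i ∈ s, ContinuousLinearMap.toSpanSingleton ℂ (T (b i)) ∘L innerSL ℂ (b i)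
    with hS
  have hSb (i : ι) : (T - S) (b i) = if i ∈ s then 0 else T (b i) := by
    have : S (b i) = if i ∈ s then T (b i) else 0 := by
      rw [hS, sum_apply]
      have (j : ι) : (ContinuousLinearMap.toSpanSingleton ℂ (T (b j)) ∘L innerSL ℂ (b j)) (b i) =
          if i = j then T (b j) else 0 := by
        have := (orthonormal_iff_ite.1 b.orthonormal) j i
        simp only [ContinuousLinearMap.comp_apply, innerSL_apply_apply, this,
          ContinuousLinearMap.toSpanSingleton_apply, eq_comm (a := i)]
        split_ifs <;> simp
      simp [this]
    rw [sub_apply, this]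
    split_ifs <;> simp
  refine ⟨S, ?_, ?_⟩
  · refine Submodule.sum_mem (compactOperator (RingHom.id ℂ) E E) fun i _ => ?_
    exact (isCompactOperator_of_locallyCompactSpace_rng
      (ContinuousLinearMap.toSpanSingleton ℂ (T (b i)))).comp_clm (innerSL ℂ (b i))
  · rw [dist_eq_norm]
    refine (opNorm_le_of_pairwise_inner_eq_zero b (fun i j hij => ?_) (half_pos hε).le
      fun i => ?_).trans_lt (half_lt_self hε)
    · simp only [hSb]
      split_ifs <;> simp [hb hij]
    · rw [hSb]
      split_ifs with hi
      · simpa using (half_pos hε).le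
      · simp only [hs, Set.Finite.mem_toFinset, Set.mem_ofPred_eq, not_le] at hi
        exact hi.le

theorem isCompactOperator_of_summable_norm_rpow (b : HilbertBasis ι ℂ E)
    (hb : Pairwise fun i j => inner ℂ (T (b i)) (T (b j)) = 0) {p : ℝ} (hp : 0 < p)
    (h : Summable fun i => ‖T (b i)‖ ^ p) : IsCompactOperator T := by
  refine isCompactOperator_of_pairwise_inner_eq_zero b hb fun ε hε => ?_
  have h1 := h.tendsto_cofinite_zero.eventually_lt_const (Real.rpow_pos_of_pos hε p)
  refine (Filter.eventually_cofinite.1 h1).subset fun i hi => ?_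
  exact not_lt.2 (Real.rpow_le_rpow hε.le hi hp.le)

end OrthogonalImage

/-! ## The trace -/

section Trace

/-- Cauchy–Schwarz for finite sums, then Bessel's inequality for each factor. -/
theorem Orthonormal.sum_norm_inner_mul_inner_le {E : Type*} [NormedAddCommGroup E]
    [InnerProductSpace ℂ E] {κ : Type*} {c : κ → E} (hc : Orthonormal ℂ c)
    (x y : E) (s : Finset κ) : ∑ k ∈ s, ‖inner ℂ x (c k) * inner ℂ (c k) y‖ ≤ ‖x‖ * ‖y‖ := by
  simp only [norm_mul, norm_inner_symm x]
  refine (Real.sum_mul_le_sqrt_mul_sqrt s _ _).trans ?_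
  gcongr
  · exact Real.sqrt_le_iff.2 ⟨norm_nonneg _, hc.sum_inner_products_le x⟩
  · exact Real.sqrt_le_iff.2 ⟨norm_nonneg _, hc.sum_inner_products_le y⟩

variable {E : Type u} [NormedAddCommGroup E] [InnerProductSpace ℂ E]
  {ι κ : Type*} {T : E →L[ℂ] E}

/-- The double series of `⟪b i, c k⟫ ⟪c k, T (b i)⟫` converges absolutely, since its row `i` is
bounded by `‖b i‖ ‖T (b i)‖ = ‖T (b i)‖`. Summing over `k` first gives `⟪b i, T (b i)⟫`; summing
over `i` first gives `⟪c k, T (c k)⟫`. -/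
theorem hasSum_inner_apply_of_summable_norm (b : HilbertBasis ι ℂ E)
    (h : Summable fun i => ‖T (b i)‖) (c : HilbertBasis κ ℂ E) :
    HasSum (fun k => inner ℂ (c k) (T (c k))) (∑' i, inner ℂ (b i) (T (b i))) := by
  let F : ι × κ → ℂ := fun x => inner ℂ (b x.1) (c x.2) * inner ℂ (c x.2) (T (b x.1))
  have hle (i : ι) (s : Finset κ) : ∑ k ∈ s, ‖F (i, k)‖ ≤ ‖T (b i)‖ := by
    simpa [F, b.orthonormal.1] using c.orthonormal.sum_norm_inner_mul_inner_le (b i) (T (b i)) s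
  have hF : Summable F := by
    refine Summable.of_norm ((summable_prod_of_nonneg fun _ => norm_nonneg _).2 ⟨fun i =>
      summable_of_sum_le (fun _ => norm_nonneg _) (hle i), ?_⟩)
    exact h.of_nonneg_of_le (fun i => tsum_nonneg fun _ => norm_nonneg _)
      fun i => Real.tsum_le_of_sum_le (fun _ => norm_nonneg _) (hle i)
  have h1 : ∑' x, F x = ∑' i, inner ℂ (b i) (T (b i)) := by
    rw [hF.tsum_prod]
    exact tsum_congr fun i => c.tsum_inner_mul_inner (b i) (T (b i))
  rw [← h1]
  refine ((Equiv.prodComm κ ι).hasSum_iff.2 hF.hasSum).prod_fiberwise fun k => ?_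
  have h2 := (b.hasSum_repr (c k)).mapL (innerSL ℂ (c k) ∘L T)
  refine h2.congr_fun fun i => ?_
  simp [F, b.repr_apply_apply]

variable [CompleteSpace E]

theorem opTrace_eq_tsum_of_summable_norm (b : HilbertBasis ι ℂ E)
    (h : Summable fun i => ‖T (b i)‖) : opTrace T = ∑' i, inner ℂ (b i) (T (b i)) :=
  (hasSum_inner_apply_of_summable_norm b h _).tsum_eq

theorem hasSum_inner_apply_opTrace (b : HilbertBasis ι ℂ E)
    (h : Summable fun i => ‖T (b i)‖) (c : HilbertBasis κ ℂ E) :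
    HasSum (fun k => inner ℂ (c k) (T (c k))) (opTrace T) := by
  rw [opTrace_eq_tsum_of_summable_norm b h]
  exact hasSum_inner_apply_of_summable_norm b h c

theorem hasTrace_opTrace_of_summable_norm (b : HilbertBasis ι ℂ E)
    (h : Summable fun i => ‖T (b i)‖) : HasTrace T (opTrace T) :=
  fun _ c => hasSum_inner_apply_opTrace b h c

end Trace

/-! ## Orthonormal bases of the Hilbert tensor product -/

namespace HilbertTensor

variable {n : ℕ} {H : Fin n → Type u} [∀ i, NormedAddCommGroup (H i)]
  [∀ i, InnerProductSpace ℂ (H i)]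

theorem norm_tprod (x : ∀ i, H i) : ‖tprod x‖ = ∏ i, ‖x i‖ := by
  refine (sq_eq_sq₀ (norm_nonneg _) (by positivity)).1 ?_
  have h := inner_tprod x x
  simp only [inner_self_eq_norm_sq_to_K] at h
  rw [← Finset.prod_pow]
  exact_mod_cast h

/-- The elementary tensors as a continuous multilinear map. -/
noncomputable def tprodL : ContinuousMultilinearMap ℂ H (HilbertTensor H) :=
  MultilinearMap.mkContinuous
    (LinearMap.compMultilinearMap (M₂ := AlgTensor H)
      (UniformSpace.Completion.toComplₗᵢ (𝕜 := ℂ) (E := AlgTensor H)).toLinearMap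
      (PiTensorProduct.tprod ℂ))
    1 fun x => by rw [one_mul]; exact (norm_tprod x).le

theorem tprodL_apply (x : ∀ i, H i) : tprodL x = tprod x := rfl

theorem topologicalClosure_span_tprod_eq_top {ι : Fin n → Type*} {v : ∀ j, ι j → H j}
    (hv : ∀ j, (Submodule.span ℂ (Set.range (v j))).topologicalClosure = ⊤) :
    (Submodule.span ℂ (Set.range fun i : ∀ j, ι j => tprod fun j => v j (i j))).topologicalClosure
      = ⊤ := by
  set K := (Submodule.span ℂ
    (Set.range fun i : ∀ j, ι j => tprod fun j => v j (i j))).topologicalClosure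
  -- Slots are freed one at a time: those in `s` carry arbitrary vectors, the others vectors of the
  -- given families. Freeing slot `a` works because the tensor is continuous and linear in it, so
  -- the admissible vectors form a closed subspace containing the range of `v a`.
  have key (s : Finset (Fin n)) :
      ∀ x : ∀ j, H j, (∀ j ∉ s, x j ∈ Set.range (v j)) → tprod x ∈ K := by
    induction s using Finset.induction_on with
    | empty =>
      intro x hx
      choose i hi using fun j => hx j (Finset.notMem_empty j)
      obtain rfl : (fun j => v j (i j)) = x := funext hi
      exact Submodule.le_topologicalClosure _ (Submodule.subset_span (Set.mem_range_self i))
    | insert a s ha ih =>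
      intro x hx
      let f : H a →L[ℂ] HilbertTensor H := tprodL.toContinuousLinearMap x a
      have hle : (Submodule.span ℂ (Set.range (v a))).topologicalClosure ≤
          K.comap (f : H a →ₗ[ℂ] HilbertTensor H) := by
        refine Submodule.topologicalClosure_minimal _ ?_
          ((Submodule.isClosed_topologicalClosure _).preimage f.continuous)
        rw [Submodule.span_le]
        rintro _ ⟨k, rfl⟩
        refine ih (Function.update x a (v a k)) fun j hj => ?_
        rcases eq_or_ne j a with rfl | h
        · simp
        · rw [Function.update_of_ne h]
          exact hx j (by simp [h, hj])
      have hmem : x a ∈ K.comap (f : H a →ₗ[ℂ] HilbertTensor H) := by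
        refine hle ?_
        rw [hv a]
        trivial
      have hfx : f (x a) = tprod x := by
        change tprodL (Function.update x a (x a)) = _
        rw [Function.update_eq_self, tprodL_apply]
      rw [← hfx]
      exact hmem
  rw [eq_top_iff, ← Submodule.dense_iff_topologicalClosure_eq_top.1 dense_span_tprod]
  refine Submodule.topologicalClosure_minimal _ ?_ (Submodule.isClosed_topologicalClosure _)
  rw [Submodule.span_le]
  rintro _ ⟨x, rfl⟩
  exact key Finset.univ x fun j hj => absurd (Finset.mem_univ j) hj

/-- The orthonormal basis of elementary tensors of basis vectors. -/
noncomputable def basis {ι : Fin n → Type*} (b : ∀ j, HilbertBasis (ι j) ℂ (H j)) :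
    HilbertBasis (∀ j, ι j) ℂ (HilbertTensor H) :=
  HilbertBasis.mk (v := fun i => tprod fun j => b j (i j))
    ⟨fun i => by simp [norm_tprod, (b _).orthonormal.1], fun i i' h => by
      obtain ⟨j, hj⟩ := Function.ne_iff.1 h
      rw [inner_tprod]
      exact Finset.prod_eq_zero (Finset.mem_univ j) ((b j).orthonormal.2 hj)⟩
    (topologicalClosure_span_tprod_eq_top fun j => (b j).dense_span).ge

theorem basis_apply {ι : Fin n → Type*} (b : ∀ j, HilbertBasis (ι j) ℂ (H j)) (i : ∀ j, ι j) :
    basis b i = tprod fun j => b j (i j) :=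
  congrFun (HilbertBasis.coe_mk _ _) i

variable {ι : Fin n → Type*} (b : ∀ j, HilbertBasis (ι j) ℂ (H j)) (A : ∀ j, H j →L[ℂ] H j)

theorem norm_map_basis (i : ∀ j, ι j) : ‖map A (basis b i)‖ = ∏ j, ‖A j (b j (i j))‖ := by
  rw [basis_apply, map_tprod, norm_tprod]

theorem inner_map_basis (i : ∀ j, ι j) :
    inner ℂ (basis b i) (map A (basis b i)) = ∏ j, inner ℂ (b j (i j)) (A j (b j (i j))) := by
  rw [basis_apply, map_tprod, inner_tprod]

theorem pairwise_inner_map_basis_eq_zero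
    (hb : ∀ j, Pairwise fun k l => inner ℂ (A j (b j k)) (A j (b j l)) = 0) :
    Pairwise fun i i' => inner ℂ (map A (basis b i)) (map A (basis b i')) = 0 := by
  intro i i' h
  obtain ⟨j, hj⟩ := Function.ne_iff.1 h
  simp only [basis_apply, map_tprod, inner_tprod]
  exact Finset.prod_eq_zero (Finset.mem_univ j) (hb j hj)

end HilbertTensor

/-! ## Diagonalisation of `T* T` for an invariant operator -/

/-- Eigenvectors of `M* M` serve: `⟪M (v k), M (v l)⟫ = ⟪v k, M* M (v l)⟫` is a multiple of `⟪v k, v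
l⟫`. -/
theorem exists_orthonormalBasis_pairwise_inner_eq_zero {d : ℕ}
    (M : EuclideanSpace ℂ (Fin d) →L[ℂ] EuclideanSpace ℂ (Fin d)) :
    ∃ v : OrthonormalBasis (Fin d) ℂ (EuclideanSpace ℂ (Fin d)),
      Pairwise fun k l => inner ℂ (M (v k)) (M (v l)) = 0 := by
  have hs : (ContinuousLinearMap.adjoint M ∘L M).toLinearMap.IsSymmetric := by
    intro x y
    simp [ContinuousLinearMap.adjoint_inner_left, ContinuousLinearMap.adjoint_inner_right]
  refine ⟨hs.eigenvectorBasis (by simp), fun k l h => ?_⟩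
  have h1 := hs.apply_eigenvectorBasis (n := d) (by simp) l
  refine (ContinuousLinearMap.adjoint_inner_right _ _ _).symm.trans ?_
  change inner ℂ _ ((ContinuousLinearMap.adjoint M ∘L M).toLinearMap _) = 0
  rw [h1, inner_smul_right, (hs.eigenvectorBasis (n := d) (by simp)).orthonormal.2 h, mul_zero]

namespace HilbertPartition

variable {E : Type u} [NormedAddCommGroup E] [InnerProductSpace ℂ E] (P : HilbertPartition E)

/-- The isometry of `ℂ^d` onto the component of dimension `d` given by its basis. -/
noncomputable def componentIsometry (ℓ : ℕ) : EuclideanSpace ℂ (Fin (P.dim ℓ)) →ₗᵢ[ℂ] E :=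
  LinearMap.isometryOfOrthonormal
    ((EuclideanSpace.basisFun (Fin (P.dim ℓ)) ℂ).toBasis.constr ℂ fun k => P.basis ⟨ℓ, k⟩)
    (v := (EuclideanSpace.basisFun (Fin (P.dim ℓ)) ℂ).toBasis)
    (by simp)
    (by
      have e : (((EuclideanSpace.basisFun (Fin (P.dim ℓ)) ℂ).toBasis.constr ℂ
          fun k => P.basis ⟨ℓ, k⟩) ∘ (EuclideanSpace.basisFun (Fin (P.dim ℓ)) ℂ).toBasis) =
          fun k => P.basis ⟨ℓ, k⟩ := funext fun k => Module.Basis.constr_basis _ _ _ _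
      rw [e]
      exact P.basis.orthonormal.comp _ sigma_mk_injective)

theorem componentIsometry_basisFun (ℓ : ℕ) (k : Fin (P.dim ℓ)) :
    P.componentIsometry ℓ (EuclideanSpace.basisFun _ ℂ k) = P.basis ⟨ℓ, k⟩ := by
  rw [← OrthonormalBasis.coe_toBasis]
  exact Module.Basis.constr_basis _ _ _ _

theorem span_range_componentIsometry {ℓ : ℕ}
    (v : OrthonormalBasis (Fin (P.dim ℓ)) ℂ (EuclideanSpace ℂ (Fin (P.dim ℓ)))) :
    Submodule.span ℂ (Set.range fun k => P.componentIsometry ℓ (v k)) =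
      LinearMap.range (P.componentIsometry ℓ).toLinearMap := by
  rw [LinearMap.range_eq_map, ← v.toBasis.span_eq, Submodule.map_span, ← Set.range_comp]
  simp [Function.comp_def]

theorem component_eq_range (ℓ : ℕ) :
    P.component ℓ = LinearMap.range (P.componentIsometry ℓ).toLinearMap := by
  rw [← P.span_range_componentIsometry (EuclideanSpace.basisFun _ ℂ), component]
  simp only [componentIsometry_basisFun]

theorem inner_componentIsometry_of_ne {ℓ m : ℕ} (h : ℓ ≠ m)
    (x : EuclideanSpace ℂ (Fin (P.dim ℓ))) (y : EuclideanSpace ℂ (Fin (P.dim m))) :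
    inner ℂ (P.componentIsometry ℓ x) (P.componentIsometry m y) = 0 := by
  rw [← (EuclideanSpace.basisFun _ ℂ).sum_repr x, ← (EuclideanSpace.basisFun _ ℂ).sum_repr y]
  have h0 (i : Fin (P.dim ℓ)) (j : Fin (P.dim m)) :
      inner ℂ (P.basis ⟨ℓ, i⟩) (P.basis ⟨m, j⟩) = 0 :=
    P.basis.orthonormal.2 fun e => h (congrArg Sigma.fst e)
  simp [componentIsometry_basisFun, -EuclideanSpace.basisFun_apply, h0]

variable {P} {T : E →L[ℂ] E}

/-- By invariance the image of `e_ℓ^k` stays in the block, so it is determined by its coordinates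
there, which form column `k` of the symbol. -/
theorem IsInvariant.apply_componentIsometry (hT : P.IsInvariant T) (ℓ : ℕ)
    (x : EuclideanSpace ℂ (Fin (P.dim ℓ))) :
    T (P.componentIsometry ℓ x) =
      P.componentIsometry ℓ (Matrix.toEuclideanCLM (𝕜 := ℂ) (P.symbol T ℓ) x) := by
  suffices h : T.toLinearMap ∘ₗ (P.componentIsometry ℓ).toLinearMap =
      (P.componentIsometry ℓ).toLinearMap ∘ₗ
        (Matrix.toEuclideanCLM (𝕜 := ℂ) (P.symbol T ℓ)).toLinearMap from
    LinearMap.congr_fun h x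
  refine (EuclideanSpace.basisFun _ ℂ).toBasis.ext fun k => ?_
  rw [OrthonormalBasis.coe_toBasis]
  change T (P.componentIsometry ℓ (EuclideanSpace.basisFun _ ℂ k)) = P.componentIsometry ℓ
    (Matrix.toEuclideanCLM (𝕜 := ℂ) (P.symbol T ℓ) (EuclideanSpace.basisFun _ ℂ k))
  have hk : T (P.basis ⟨ℓ, k⟩) ∈ P.component ℓ :=
    hT ℓ _ (Submodule.subset_span (Set.mem_range_self k))
  rw [component_eq_range] at hk
  obtain ⟨y, hy⟩ := hk
  change P.componentIsometry ℓ y = _ at hy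
  rw [componentIsometry_basisFun, ← hy]
  congr 1
  ext m
  have h1 : inner ℂ (P.basis ⟨ℓ, m⟩) (T (P.basis ⟨ℓ, k⟩)) = y m := by
    rw [← hy, ← componentIsometry_basisFun, LinearIsometry.inner_map_map,
      EuclideanSpace.basisFun_apply, EuclideanSpace.inner_single_left]
    simp
  rw [← h1, EuclideanSpace.basisFun_apply, Matrix.ofLp_toEuclideanCLM]
  simp [symbol]

variable [CompleteSpace E]

/-- The orthonormal basis glued from orthonormal bases of the components. -/
noncomputable def gluedBasis (P : HilbertPartition E)
    (v : ∀ ℓ, OrthonormalBasis (Fin (P.dim ℓ)) ℂ (EuclideanSpace ℂ (Fin (P.dim ℓ)))) :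
    HilbertBasis (Σ ℓ : ℕ, Fin (P.dim ℓ)) ℂ E :=
  HilbertBasis.mk (v := fun i : Σ ℓ : ℕ, Fin (P.dim ℓ) => P.componentIsometry i.1 (v i.1 i.2))
    ⟨fun i => by simp, by
      rintro ⟨ℓ, k⟩ ⟨m, l⟩ h
      rcases eq_or_ne ℓ m with rfl | h'
      · have : k ≠ l := fun e => h (by rw [e])
        simpa using (v ℓ).orthonormal.2 this
      · exact P.inner_componentIsometry_of_ne h' _ _⟩
    (by
      -- The new vectors of a block span that block, hence their span contains the original basis.
      rw [← P.basis.dense_span]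
      refine Submodule.topologicalClosure_mono ?_
      rw [Submodule.span_le]
      rintro _ ⟨⟨ℓ, k⟩, rfl⟩
      have h1 : P.basis ⟨ℓ, k⟩ ∈ P.component ℓ := Submodule.subset_span (Set.mem_range_self k)
      rw [component_eq_range, ← P.span_range_componentIsometry (v ℓ)] at h1
      refine Submodule.span_mono ?_ h1
      rintro _ ⟨l, rfl⟩
      exact ⟨⟨ℓ, l⟩, rfl⟩)

theorem gluedBasis_apply (P : HilbertPartition E)
    (v : ∀ ℓ, OrthonormalBasis (Fin (P.dim ℓ)) ℂ (EuclideanSpace ℂ (Fin (P.dim ℓ))))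
    (i : Σ ℓ : ℕ, Fin (P.dim ℓ)) : P.gluedBasis v i = P.componentIsometry i.1 (v i.1 i.2) :=
  congrFun (HilbertBasis.coe_mk _ _) i

theorem matrixSchattenNorm_rpow_eq_sum {d : ℕ} (M : Matrix (Fin d) (Fin d) ℂ)
    (v : OrthonormalBasis (Fin d) ℂ (EuclideanSpace ℂ (Fin d)))
    (hv : Pairwise fun k l => inner ℂ (Matrix.toEuclideanCLM (𝕜 := ℂ) M (v k))
      (Matrix.toEuclideanCLM (𝕜 := ℂ) M (v l)) = 0) {p : ℝ} (hp : 0 < p) :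
    matrixSchattenNorm p M ^ p = ∑ k, ‖Matrix.toEuclideanCLM (𝕜 := ℂ) M (v k)‖ ^ p := by
  have hc : IsCompactOperator (Matrix.toEuclideanCLM (𝕜 := ℂ) M) :=
    isCompactOperator_of_locallyCompactSpace_dom _
  rw [matrixSchattenNorm, schattenNorm_eq_tsum hc v.toHilbertBasis (by simpa using hv) hp,
    ← Real.rpow_mul (tsum_nonneg fun _ => by positivity), one_div_mul_cancel hp.ne', Real.rpow_one,
    tsum_fintype]
  simp

/-- Each symbol is treated separately: invariance keeps images from different blocks orthogonal. The
basis does not depend on `p`. -/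
theorem IsInvariant.exists_hilbertBasis (hT : P.IsInvariant T) :
    ∃ b : HilbertBasis (Σ ℓ : ℕ, Fin (P.dim ℓ)) ℂ E,
      (Pairwise fun i j => inner ℂ (T (b i)) (T (b j)) = 0) ∧
      ∀ p > 0, ∀ ℓ, matrixSchattenNorm p (P.symbol T ℓ) ^ p = ∑ k, ‖T (b ⟨ℓ, k⟩)‖ ^ p := by
  choose v hv using fun ℓ => exists_orthonormalBasis_pairwise_inner_eq_zero
    (Matrix.toEuclideanCLM (𝕜 := ℂ) (P.symbol T ℓ))
  refine ⟨P.gluedBasis v, ?_, fun p hp ℓ => ?_⟩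
  · rintro ⟨ℓ, k⟩ ⟨m, l⟩ h
    simp only [gluedBasis_apply, hT.apply_componentIsometry]
    rcases eq_or_ne ℓ m with rfl | h'
    · rw [LinearIsometry.inner_map_map]
      exact hv ℓ fun e => h (by rw [e])
    · exact P.inner_componentIsometry_of_ne h' _ _
  · simp only [gluedBasis_apply, hT.apply_componentIsometry, LinearIsometry.norm_map]
    exact matrixSchattenNorm_rpow_eq_sum _ (v ℓ) (hv ℓ) hp

end HilbertPartition

/-! ### Schatten norms and traces of the tensor product -/

theorem mainTheorem1 {n : ℕ} (H : Fin n → Type u) [∀ j, NormedAddCommGroup (H j)]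
    [∀ j, InnerProductSpace ℂ (H j)] [∀ j, CompleteSpace (H j)]
    (P : ∀ j, HilbertPartition (H j)) (A : ∀ j, H j →L[ℂ] H j)
    (hinv : ∀ j, (P j).IsInvariant (A j)) (p : ℝ) (hp : 0 < p)
    (hA : ∀ j, MemSchatten p (A j)) :
    MemSchatten p (HilbertTensor.map A) ∧
    schattenNorm p (HilbertTensor.map A) = ∏ j, schattenNorm p (A j) ∧
    (∀ j, Summable fun ℓ => matrixSchattenNorm p ((P j).symbol (A j) ℓ) ^ p) ∧
    ∏ j, schattenNorm p (A j) =
      ∏ j, (∑' ℓ, matrixSchattenNorm p ((P j).symbol (A j) ℓ) ^ p) ^ (1 / p) ∧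
    (p = 1 →
      HasTrace (HilbertTensor.map A) (opTrace (HilbertTensor.map A)) ∧
      (∀ j, HasTrace (A j) (opTrace (A j))) ∧
      opTrace (HilbertTensor.map A) = ∏ j, opTrace (A j) ∧
      (∀ j, Summable fun ℓ => ((P j).symbol (A j) ℓ).trace) ∧
      ∏ j, opTrace (A j) = ∏ j, ∑' ℓ, ((P j).symbol (A j) ℓ).trace) := by
  choose b hb hsymb using fun j => (hinv j).exists_hilbertBasis
  have hs (j : Fin n) : Summable fun i => ‖A j (b j i)‖ ^ p :=
    (memSchatten_iff_summable (hA j).1 (b j) (hb j) hp).1 (hA j)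
  have hnorm (j : Fin n) := schattenNorm_eq_tsum (hA j).1 (b j) (hb j) hp
  have hsum (j : Fin n) :
      HasSum (fun ℓ => matrixSchattenNorm p ((P j).symbol (A j) ℓ) ^ p)
        (∑' i, ‖A j (b j i)‖ ^ p) := by
    refine (hs j).hasSum.sigma fun ℓ => ?_
    rw [hsymb j p hp]
    exact hasSum_fintype _
  have hbt := HilbertTensor.pairwise_inner_map_basis_eq_zero b A hb
  have hnt (i : ∀ j, Σ ℓ : ℕ, Fin ((P j).dim ℓ)) :
      ‖HilbertTensor.map A (HilbertTensor.basis b i)‖ ^ p = ∏ j, ‖A j (b j (i j))‖ ^ p := by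
    rw [HilbertTensor.norm_map_basis, Real.finsetProd_rpow _ _ fun _ _ => norm_nonneg _]
  obtain ⟨ht, ht'⟩ := summable_norm_prod_and_tsum_prod_eq
    (f := fun j i => ‖A j (b j i)‖ ^ p) fun j => (hs j).norm
  have hst : Summable fun i => ‖HilbertTensor.map A (HilbertTensor.basis b i)‖ ^ p := by
    simp only [hnt]
    exact ht.of_norm
  have hct := isCompactOperator_of_summable_norm_rpow _ hbt hp hst
  refine ⟨(memSchatten_iff_summable hct _ hbt hp).2 hst, ?_, fun j => (hsum j).summable, ?_, ?_⟩
  · rw [schattenNorm_eq_tsum hct _ hbt hp]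
    simp only [hnt, hnorm, ht']
    exact (Real.finsetProd_rpow _ _ (fun j _ => tsum_nonneg fun _ => by positivity) _).symm
  · simp only [hnorm, (hsum _).tsum_eq]
  · rintro rfl
    simp only [Real.rpow_one] at hs hst
    have htr (j : Fin n) :
        HasSum (fun ℓ => ((P j).symbol (A j) ℓ).trace) (opTrace (A j)) := by
      -- Summability is known in `b j`, but the trace is read off in the original basis, where block
      -- `ℓ` contributes the diagonal of the symbol.
      refine (hasSum_inner_apply_opTrace (b j) (hs j) (P j).basis).sigma fun ℓ => ?_
      exact hasSum_fintype _
    refine ⟨hasTrace_opTrace_of_summable_norm _ hst,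
      fun j => hasTrace_opTrace_of_summable_norm (b j) (hs j), ?_, fun j => (htr j).summable, ?_⟩
    · rw [opTrace_eq_tsum_of_summable_norm _ hst]
      simp only [HilbertTensor.inner_map_basis,
        fun j => opTrace_eq_tsum_of_summable_norm (b j) (hs j)]
      refine (summable_norm_prod_and_tsum_prod_eq
        (f := fun j i => inner ℂ (b j i) (A j (b j i))) fun j => ?_).2
      -- Unconditional convergence in `ℂ` is absolute convergence.
      exact (hasSum_inner_apply_opTrace (b j) (hs j) (b j)).summable.norm
    · simp only [(htr _).tsum_eq]
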